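/- Let $G$ be a 4-dimensional connected Lie group with Lie algebra $\mathfrak g$, let $\mathfrak q\subset\mathfrak g$ be a 3-dimensional subspace generating $\mathfrak g$, and let $F:\mathfrak q\to\mathbb R$ be a (not necessarily symmetric) seminorm, i.e. $F(u+v)\le F(u)+F(v)$ and $F(cu)=cF(u)$ for $c\ge 0$, with $F(u)>0$ for $u\ne0$; it defines a left-invariant sub-Finsler quasimetric on $G$. Put $U=\{u\in\mathfrak q: F(u)\le 1\}$ and $l_g(h)=gh$. An absolutely continuous curve $g:\mathbb R\to G$ is an *extremal* if there are a measurable control $u:\mathbb R\to\mathfrak q$, a constant $M\ge 0$ and a nowhere zero absolutely continuous covector function $\psi(t)\in T^*_{g(t)}G$ such that for almost all $t$: $\dot g(t)=dl_{g(t)}(u(t))$, $F(u(t))=1$, $\psi$ satisfies the adjoint (Hamiltonian) equation of the Pontryagin Maximum Principle for the Hamiltonian $\mathcal H(g,\psi,u)=\psi(dl_g(u))$, and $$\psi(t)(dl_{g(t)}u(t))=\max_{v\in U}\psi(t)(dl_{g(t)}v)=M .$$ The extremal is *abnormal* if this holds with $M=0$ and *normal* if it holds with some $M>0$ (for some $u,\psi$);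 an abnormal extremal is *nonstrongly abnormal* if it is also normal. Suppose that $(e_1,e_2,e_3)$ is a basis of $\mathfrak q$ such that $e_3=[e_1,e_2]$, the vectors $e_1,e_2,e_3,e_4:=[e_1,e_3]$ form a basis of $\mathfrak g$, and the structure constants, $[e_i,e_j]=\sum_k C_{ij}^k e_k$, satisfy $C_{12}^4=C_{23}^4=0$. Write $F(u_1,u_2,u_3)=F(u_1e_1+u_2e_2+u_3e_3)$ and $$F_U(x,y,z)=\max\{xu_1+yu_2+zu_3 : F(u_1,u_2,u_3)\le 1\}.$$ **Theorem.** For each $s\in\{1,-1\}$ the curve $g(t)=\exp\!\left(\frac{s\,t\,e_2}{F(se_2)}\right)$, $t\in\mathbb R$, is an abnormal extremal, and it is nonstrongly abnormal if and only if one of the following two conditions holds: 1. $C_{23}^1=C_{23}^2=0$ and there is $k\in\mathbb R$ (depending on $s$) with $F_U(k,s,0)=1/F(0,s,0)$; 2. $C_{23}^1\neq0$ and $F_U\!\left(-C_{23}^2\,s/C_{23}^1,\,s,\,0\right)=1/F(0,s,0)$. -/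

import Mathlib

open Set MeasureTheory VectorField
open scoped Manifold ContDiff Topology

noncomputable section

theorem mulInvariantVectorField_mul_left {E : Type*} [NormedAddCommGroup E] [NormedSpace ℝ E]
    {H : Type*} [TopologicalSpace H] (I : ModelWithCorners ℝ E H)
    {G : Type*} [TopologicalSpace G] [ChartedSpace H G] [Group G]
    [LieGroup I (minSmoothness ℝ 3) G] (X : GroupLieAlgebra I G) (g h : G) :
    mulInvariantVectorField X (g * h) =
      mfderiv I I (fun x => g * x) h (mulInvariantVectorField X h) := by
  have M : minSmoothness ℝ 3 ≠ 0 := lt_of_lt_of_le (by simp) le_minSmoothness |>.ne'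
  have D : (fun x => g * h * x) = (fun x => g * x) ∘ (fun x => h * x) := by
    ext x; simp [mul_assoc]
  have hd : ∀ a b : G, MDifferentiableAt I I (fun x => a * x) b := fun a b =>
    contMDiff_mul_left.contMDiffAt.mdifferentiableAt M
  have key := mfderiv_comp (I := I) (I' := I) (I'' := I) (1 : G) (hd g (h * 1)) (hd h 1)
  rw [← D, mul_one] at key
  exact congrArg (fun L => L X) key

theorem isMIntegralCurveOn_mul_left {E : Type*} [NormedAddCommGroup E] [NormedSpace ℝ E]
    {H : Type*} [TopologicalSpace H] (I : ModelWithCorners ℝ E H)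
    {G : Type*} [TopologicalSpace G] [ChartedSpace H G] [Group G]
    [LieGroup I (minSmoothness ℝ 3) G] (X : GroupLieAlgebra I G) {γ : ℝ → G} {s : Set ℝ}
    (hγ : IsMIntegralCurveOn (I := I) γ (mulInvariantVectorField X) s) (g : G) :
    IsMIntegralCurveOn (I := I) (fun t => g * γ t) (mulInvariantVectorField X) s := by
  intro t ht
  have M : minSmoothness ℝ 3 ≠ 0 := lt_of_lt_of_le (by simp) le_minSmoothness |>.ne'
  have h1 : HasMFDerivAt I I (fun x => g * x) (γ t) (mfderiv I I (fun x => g * x) (γ t)) :=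
    (contMDiff_mul_left (I := I) (n := minSmoothness ℝ 3)
      |>.contMDiffAt.mdifferentiableAt M).hasMFDerivAt
  have h2 := h1.comp_hasMFDerivWithinAt t (hγ t ht)
  have h3 : (mfderiv I I (fun x => g * x) (γ t)).comp
      ((1 : ℝ →L[ℝ] ℝ).smulRight (mulInvariantVectorField X (γ t))) =
      (1 : ℝ →L[ℝ] ℝ).smulRight (mulInvariantVectorField X (g * γ t)) := by
    rw [mulInvariantVectorField_mul_left]
    refine ContinuousLinearMap.ext fun r => ?_
    exact (mfderiv I I (fun x => g * x) (γ t)).map_smul ((1 : ℝ →L[ℝ] ℝ) r) _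
  exact (congrArg (fun L => HasMFDerivWithinAt 𝓘(ℝ, ℝ) I (fun t => g * γ t) s t L) h3).mp h2

/-- Every left-invariant vector field has a global integral curve issuing from the unit. -/
theorem exists_isMIntegralCurve_mulInvariantVectorField
    {E : Type*} [NormedAddCommGroup E] [NormedSpace ℝ E] [CompleteSpace E]
    {H : Type*} [TopologicalSpace H] (I : ModelWithCorners ℝ E H)
    {G : Type*} [TopologicalSpace G] [ChartedSpace H G] [Group G]
    [LieGroup I (minSmoothness ℝ 3) G] [T2Space G] [BoundarylessManifold I G]
    (X : GroupLieAlgebra I G) :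
    ∃ γ : ℝ → G, γ 0 = 1 ∧ IsMIntegralCurve (I := I) γ (mulInvariantVectorField X) := by
  have hv : ContMDiff I I.tangent 1
      (fun x : G => (⟨x, mulInvariantVectorField X x⟩ : TangentBundle I G)) :=
    (contMDiff_mulInvariantVectorField X).of_le (by simp)
  obtain ⟨γ, h0, hγ⟩ := exists_isMIntegralCurveAt_of_contMDiffAt_boundaryless (I := I) 0
    (hv.contMDiffAt (x := (1 : G)))
  rw [isMIntegralCurveAt_iff'] at hγ
  obtain ⟨ε, hε, hγ⟩ := hγ
  rw [Real.ball_eq_Ioo, zero_sub, zero_add] at hγ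
  exact exists_isMIntegralCurve_of_isMIntegralCurveOn hv hε
    (fun x => ⟨fun t => x * γ t, by simp [h0], isMIntegralCurveOn_mul_left I X hγ x⟩) 1

/-- The exponential map of a Lie group: `exp X = γ 1`, where `γ` is the integral curve (unique, as
`G` is Hausdorff) issuing from the unit of the left-invariant vector field defined by `X`. -/
def lieExp {E : Type*} [NormedAddCommGroup E] [NormedSpace ℝ E] [CompleteSpace E]
    {H : Type*} [TopologicalSpace H] (I : ModelWithCorners ℝ E H)
    {G : Type*} [TopologicalSpace G] [ChartedSpace H G] [Group G]
    [LieGroup I (minSmoothness ℝ 3) G] [T2Space G] [BoundarylessManifold I G]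
    (X : GroupLieAlgebra I G) : G :=
  (exists_isMIntegralCurve_mulInvariantVectorField I X).choose 1

/-- A (not necessarily symmetric) seminorm `F` on a real vector space which is positive on nonzero
vectors: it is subadditive and positively homogeneous. -/
structure IsPositiveSeminorm {V : Type*} [AddCommGroup V] [Module ℝ V] (F : V → ℝ) : Prop where
  add_le : ∀ u v, F (u + v) ≤ F u + F v
  smul_eq : ∀ c : ℝ, 0 ≤ c → ∀ u, F (c • u) = c * F u
  pos : ∀ u, u ≠ 0 → 0 < F u

section Extremals

variable {E : Type*} [NormedAddCommGroup E] [NormedSpace ℝ E]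
  {H : Type*} [TopologicalSpace H] (I : ModelWithCorners ℝ E H)
  {G : Type*} [TopologicalSpace G] [ChartedSpace H G] [IsManifold I 1 G] [Group G]

/-- A `C¹` vector field on `G`. -/
def IsC1VectorField (Y : (x : G) → TangentSpace I x) : Prop :=
  ContMDiff I I.tangent 1 (fun x => (⟨x, Y x⟩ : TangentBundle I G))

/-- A curve `g : ℝ → G` is (locally) absolutely continuous: it is continuous, and so is, on every
compact interval, its composition with every `C¹` function in the sense of absolute continuity of
real functions. -/
def IsACCurve (g : ℝ → G) : Prop :=
  Continuous g ∧ ∀ f : G → ℝ, ContMDiff I 𝓘(ℝ, ℝ) 1 f →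
    ∀ a b : ℝ, AbsolutelyContinuousOnInterval (fun t => f (g t)) a b

/-- A covector function `ψ t ∈ T*_{g t} G` along a curve `g` is (locally) absolutely continuous:
its pairing with every `C¹` vector field is absolutely continuous on every compact interval. -/
def IsACCovector (g : ℝ → G) (ψ : (t : ℝ) → (TangentSpace I (g t) →L[ℝ] ℝ)) : Prop :=
  ∀ Y : (x : G) → TangentSpace I x, IsC1VectorField I Y →
    ∀ a b : ℝ, AbsolutelyContinuousOnInterval (fun t => ψ t (Y (g t))) a b

/-- The curve `g : ℝ → G`, with control `u` and covector function `ψ`, satisfies the Pontryagin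
Maximum Principle, with constant value `M` of the maximized Hamiltonian, for the left-invariant
time-optimal problem `ġ = dl_g(u)`, `u ∈ U = {v ∈ q | F v ≤ 1}`, and is parametrized by arclength:
`F (u t) = 1` almost everywhere.  Here `dl_g(v)` is `mulInvariantVectorField v g`, and
`ℋ(g, ψ, u) = ψ (dl_g(u))`.  The domain of the curve is `ℝ`, hence automatically maximal. -/
structure SatisfiesPMP (q : Submodule ℝ (GroupLieAlgebra I G)) (F : q → ℝ) (g : ℝ → G)
    (u : ℝ → q) (ψ : (t : ℝ) → (TangentSpace I (g t) →L[ℝ] ℝ)) (M : ℝ) : Prop where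
  /-- the control is Borel measurable -/
  measurable_control : @Measurable ℝ q _ (borel q) u
  /-- the trajectory is absolutely continuous -/
  ac_curve : IsACCurve I g
  /-- the control system `ġ = dl_g(u)` -/
  deriv_curve : ∀ᵐ t : ℝ, HasMFDerivAt 𝓘(ℝ, ℝ) I g t
    ((1 : ℝ →L[ℝ] ℝ).smulRight
      (mulInvariantVectorField (u t : GroupLieAlgebra I G) (g t)))
  /-- arclength parametrization; in particular the control takes its values in `U` -/
  arclength : ∀ᵐ t : ℝ, F (u t) = 1
  /-- the covector function vanishes nowhere -/
  ne_zero : ∀ t : ℝ, ψ t ≠ 0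
  /-- the covector function is absolutely continuous -/
  ac_covector : IsACCovector I g ψ
  /-- the adjoint (Hamiltonian) equation `ψ̇ = -∂ℋ/∂g` in coordinate-free form: with `X` the
  left-invariant vector field defined by the current value of the control,
  `d/dt ψ(Y) = ψ([X, Y])` for all vector fields `Y`.  (In a chart, for the coordinate fields `Y`,
  this is `ψ̇_i = -∑_k ψ_k ∂X^k/∂x^i`.) -/
  adjoint : ∀ᵐ t : ℝ, ∀ Y : (x : G) → TangentSpace I x, IsC1VectorField I Y →
    HasDerivAt (fun τ => ψ τ (Y (g τ)))
      (ψ t (mlieBracket I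
        (mulInvariantVectorField (u t : GroupLieAlgebra I G)) Y (g t))) t
  /-- the Hamiltonian takes the value `M` at the control -/
  hamiltonian_eq : ∀ᵐ t : ℝ,
    ψ t (mulInvariantVectorField (u t : GroupLieAlgebra I G) (g t)) = M
  /-- and this value is its maximum over `U` -/
  hamiltonian_le : ∀ᵐ t : ℝ, ∀ v : q, F v ≤ 1 →
    ψ t (mulInvariantVectorField (v : GroupLieAlgebra I G) (g t)) ≤ M

/-- The curve `g : ℝ → G` is an abnormal extremal: it satisfies the Pontryagin Maximum Principle
with `M = 0` for some control and covector function. -/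
def IsAbnormalExtremal (q : Submodule ℝ (GroupLieAlgebra I G)) (F : q → ℝ) (g : ℝ → G) : Prop :=
  ∃ (u : ℝ → q) (ψ : (t : ℝ) → (TangentSpace I (g t) →L[ℝ] ℝ)), SatisfiesPMP I q F g u ψ 0

/-- The curve `g : ℝ → G` is a normal extremal: it satisfies the Pontryagin Maximum Principle
with some `M > 0` for some control and covector function. -/
def IsNormalExtremal (q : Submodule ℝ (GroupLieAlgebra I G)) (F : q → ℝ) (g : ℝ → G) : Prop :=
  ∃ (u : ℝ → q) (ψ : (t : ℝ) → (TangentSpace I (g t) →L[ℝ] ℝ)) (M : ℝ),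
    0 < M ∧ SatisfiesPMP I q F g u ψ M

/-- An abnormal extremal is nonstrongly abnormal if it is also normal (in general with respect to
another covector function). -/
def IsNonstronglyAbnormal (q : Submodule ℝ (GroupLieAlgebra I G)) (F : q → ℝ) (g : ℝ → G) : Prop :=
  IsAbnormalExtremal I q F g ∧ IsNormalExtremal I q F g

end Extremals

/-- The structure constant `C_{ij}^k` of a real Lie algebra in the basis `e`. The indices start from
`0`: the classical `e₁, e₂, e₃, e₄` are `e 0, e 1, e 2, e 3`. -/
def structConst {L : Type*} [LieRing L] [LieAlgebra ℝ L] (e : Module.Basis (Fin 4) ℝ L)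
    (i j k : Fin 4) : ℝ :=
  e.repr ⁅e i, e j⁆ k

/-- The basis `(e₁, e₂, e₃, e₄)` of the four-dimensional Lie algebra `L` is adapted to the subspace
`q`: `(e₁, e₂, e₃)` is a basis of `q`, `e₄ = [e₁, e₃]`, and `C_{12}^4 = C_{23}^4 = 0`. -/
structure IsAdaptedBasis {L : Type*} [LieRing L] [LieAlgebra ℝ L] (q : Submodule ℝ L)
    (e : Module.Basis (Fin 4) ℝ L) : Prop where
  span_eq : Submodule.span ℝ {e 0, e 1, e 2} = q
  e4_eq : e 3 = ⁅e 0, e 2⁆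
  c124 : structConst e 0 1 3 = 0
  c234 : structConst e 1 2 3 = 0

/-- The linear combination `a e₁ + b e₂ + c e₃` as a vector of `q`. -/
def IsAdaptedBasis.vec {L : Type*} [LieRing L] [LieAlgebra ℝ L] {q : Submodule ℝ L}
    {e : Module.Basis (Fin 4) ℝ L} (he : IsAdaptedBasis q e) (a b c : ℝ) : q :=
  ⟨a • e 0 + b • e 1 + c • e 2, by
    have h : ∀ v ∈ ({e 0, e 1, e 2} : Set L), v ∈ q := fun v hv =>
      he.span_eq ▸ Submodule.subset_span hv
    exact q.add_mem (q.add_mem (q.smul_mem a (h _ (by simp))) (q.smul_mem b (h _ (by simp))))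
      (q.smul_mem c (h _ (by simp)))⟩

/-- The Minkowski support function of the unit ball `U = {u ∈ q | F u ≤ 1}` in the coordinates
defined by the basis: `F_U(x, y, z) = max {x u₁ + y u₂ + z u₃ | F(u₁, u₂, u₃) ≤ 1}`.  (For a
positive seminorm `F`, `U` is compact and contains `0`, so the supremum is a maximum.) -/
def IsAdaptedBasis.support {L : Type*} [LieRing L] [LieAlgebra ℝ L] {q : Submodule ℝ L}
    {e : Module.Basis (Fin 4) ℝ L} (he : IsAdaptedBasis q e) (F : q → ℝ) (x y z : ℝ) : ℝ :=
  sSup {r : ℝ | ∃ u₁ u₂ u₃ : ℝ, F (he.vec u₁ u₂ u₃) ≤ 1 ∧ r = x * u₁ + y * u₂ + z * u₃}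

end

/-!
Vectors and structure constants carry here the classical indices from `1` to `4`, so that
`C_{23}^1` is `structConst e 1 2 0`. Write `c = s / F (0, s, 0)` and `X = c e₂` for the velocity of
the curve. A covector function along the curve is read in the dual of the Lie algebra by left
translation (`maurerCartan`, `leftPairing`); the adjoint equation then becomes the linear equation
`l' = l ∘ ad X`. It is enough to test it on left-invariant fields, because they form a global frame
in which `C¹` fields have `C¹` coefficients (`IsC1VectorField.hasDerivAt_pairing_of_coadjoint`).
Since the left-invariant fields of different vectors differ everywhere, the curve determines its
control almost everywhere (`SatisfiesPMP.ae_control_eq`).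

*Abnormality.* As `C_{23}^4 = 0` and `[e₂, e₁] = -e₃`, the covector `e₄*` is an eigenvector of the
coadjoint action of `e₂`; its multiples by an exponential solve the equation and vanish on `q`.

*Normality.* With `x, y, z` the values of the covector on `e₁, e₂, e₃`, the equation reads
`x' = -c z`, `y' = 0`, `z' = c (C_{23}^1 x + C_{23}^2 y + C_{23}^3 z)`, and the maximum condition
says that `(x, y, z)` lies in `M` times the polar of the unit ball, with `c y = M`. This set is
bounded and convex, so the time averages of a solution accumulate in it; the averages of the
derivatives `x'`, `z'` of bounded functions tend to zero, hence the limit is an equilibrium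
`(m, y, 0)` with `C_{23}^1 m + C_{23}^2 y = 0` (`exists_equilibrium_of_bounded`). Conversely an
equilibrium in the polar, extended by `0` on `e₄`, is a constant solution. After normalization by
`y = s`, normality thus means that there is `k` with `C_{23}^1 k + C_{23}^2 s = 0` and
`F_U (k, s, 0) = 1 / F (0, s, 0)`; solving the first equation for `k` gives the two cases.
-/

/-! ### Absolutely continuous functions and time averages -/

theorem absolutelyContinuousOnInterval_sum {ι F : Type*} [NormedAddCommGroup F] [NormedSpace ℝ F]
    {f : ι → ℝ → F} {a b : ℝ} (s : Finset ι)
    (hf : ∀ i ∈ s, AbsolutelyContinuousOnInterval (f i) a b) :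
    AbsolutelyContinuousOnInterval (fun t => ∑ i ∈ s, f i t) a b := by
  classical
  induction s using Finset.induction_on with
  | empty =>
    simpa using (LipschitzWith.const (0 : F)).lipschitzOnWith.absolutelyContinuousOnInterval
  | insert i s hi ih =>
    simp only [Finset.sum_insert hi]
    exact (hf i (Finset.mem_insert_self _ _)).add
      (ih fun j hj => hf j (Finset.mem_insert_of_mem hj))

theorem absolutelyContinuousOnInterval_of_hasDerivAt {f f' : ℝ → ℝ}
    (hf : ∀ t, HasDerivAt f (f' t) t) (hf' : Continuous f') (a b : ℝ) :
    AbsolutelyContinuousOnInterval f a b := by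
  refine ContDiffOn.absolutelyContinuousOnInterval (ContDiff.contDiffOn ?_)
  rw [contDiff_one_iff_deriv]
  exact ⟨fun t => (hf t).differentiableAt, by
    rwa [show deriv f = f' from funext fun t => (hf t).deriv]⟩

theorem continuous_of_absolutelyContinuousOnInterval {f : ℝ → ℝ}
    (hf : ∀ a b, AbsolutelyContinuousOnInterval f a b) : Continuous f := by
  refine continuous_iff_continuousAt.2 fun t => ?_
  refine (hf (t - 1) (t + 1)).continuousOn.continuousAt ?_
  rw [uIcc_of_le (by linarith)]
  exact Icc_mem_nhds (by linarith) (by linarith)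

theorem integral_eq_sub_of_ae_hasDerivAt {f f' : ℝ → ℝ} {a b : ℝ}
    (hf : AbsolutelyContinuousOnInterval f a b) (hf' : ∀ᵐ t, HasDerivAt f (f' t) t) :
    ∫ t in a..b, f' t = f b - f a := by
  rw [← hf.integral_deriv_eq_sub]
  refine intervalIntegral.integral_congr_ae ?_
  filter_upwards [hf'] with t ht _ using ht.deriv.symm

theorem forall_le_of_ae_le {f : ℝ → ℝ} (hf : Continuous f) {M : ℝ} (h : ∀ᵐ t, f t ≤ M) (t : ℝ) :
    f t ≤ M :=
  (isClosed_le hf continuous_const).closure_subset (Measure.dense_of_ae h t)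

theorem tendsto_sub_div_atTop_of_bounded {f : ℝ → ℝ} {C : ℝ} (hf : ∀ t, |f t| ≤ C) :
    Filter.Tendsto (fun n : ℕ => (f n - f 0) / n) Filter.atTop (𝓝 0) := by
  refine squeeze_zero_norm (a := fun n : ℕ => (2 * C) / n) (fun n => ?_)
    (tendsto_const_div_atTop_nhds_zero_nat _)
  rw [Real.norm_eq_abs, abs_div, Nat.abs_cast]
  gcongr
  calc |f n - f 0| ≤ |f n| + |f 0| := abs_sub _ _
    _ ≤ 2 * C := by linarith [hf n, hf 0]

/-- Time averages along a bounded solution of the linear system `x' = -c z`,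
`z' = c (α x + β y + δ z)` with constant `y` accumulate at an equilibrium `(m, 0)`, and every
inequality `r x + k z ≤ C` satisfied by the solution passes to the limit. -/
theorem exists_equilibrium_of_bounded {x z : ℝ → ℝ} (hx : Continuous x) (hz : Continuous z)
    {Cx Cz : ℝ} (hbx : ∀ t, |x t| ≤ Cx) (hbz : ∀ t, |z t| ≤ Cz) {c α β δ y : ℝ} (hc : c ≠ 0)
    (hxz : ∀ T, ∫ t in (0 : ℝ)..T, -c * z t = x T - x 0)
    (hzx : ∀ T, ∫ t in (0 : ℝ)..T, c * (α * x t + β * y + δ * z t) = z T - z 0) :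
    ∃ m, α * m + β * y = 0 ∧ ∀ r k C : ℝ, (∀ t, r * x t + k * z t ≤ C) → r * m ≤ C := by
  let A : (ℝ → ℝ) → ℕ → ℝ := fun f n => (∫ t in (0 : ℝ)..n, f t) / n
  have hAx : ∀ n, A x n ∈ Icc (-Cx) Cx := fun n => by
    rw [mem_Icc, ← abs_le, abs_div, Nat.abs_cast]
    have h := intervalIntegral.norm_integral_le_of_norm_le_const (a := 0) (b := n) (C := Cx)
      (f := x) fun t _ => hbx t
    rw [sub_zero, Nat.abs_cast] at h
    exact div_le_of_le_mul₀ (Nat.cast_nonneg _) ((abs_nonneg _).trans (hbx 0)) h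
  obtain ⟨m, -, φ, hφ, hm⟩ := isCompact_Icc.tendsto_subseq hAx
  -- The average of `z` is, up to a constant, that of the derivative of the bounded function `x`.
  have hAz : Filter.Tendsto (A z) Filter.atTop (𝓝 0) := by
    have h := (tendsto_sub_div_atTop_of_bounded hbx).const_mul (-c)⁻¹
    rw [mul_zero] at h
    refine h.congr fun n => ?_
    rw [← hxz, intervalIntegral.integral_const_mul]
    simp only [A]
    field_simp
  have hAzφ := hAz.comp hφ.tendsto_atTop
  have hpos : ∀ᶠ n in Filter.atTop, (φ n : ℝ) ≠ 0 := by
    filter_upwards [hφ.tendsto_atTop.eventually_gt_atTop 0] with n hn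
    exact_mod_cast hn.ne'
  have ix : ∀ a b, IntervalIntegrable x volume a b := fun a b => hx.intervalIntegrable a b
  have iz : ∀ a b, IntervalIntegrable z volume a b := fun a b => hz.intervalIntegrable a b
  refine ⟨m, ?_, fun r k C hC => ?_⟩
  -- The left-hand side is the limit of the averages of `z' / c`, and `z` is bounded.
  · have h1 := ((tendsto_sub_div_atTop_of_bounded hbz).comp hφ.tendsto_atTop).const_mul c⁻¹
    rw [mul_zero] at h1
    have h2 := ((hm.const_mul α).add_const (β * y)).add (hAzφ.const_mul δ)
    rw [mul_zero, add_zero] at h2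
    refine tendsto_nhds_unique h2 (h1.congr' ?_)
    filter_upwards [hpos] with n hn
    simp only [Function.comp_apply, A]
    rw [← hzx, intervalIntegral.integral_const_mul, intervalIntegral.integral_add
      (((ix _ _).const_mul _).add intervalIntegrable_const) ((iz _ _).const_mul _),
      intervalIntegral.integral_add ((ix _ _).const_mul _) intervalIntegrable_const,
      intervalIntegral.integral_const_mul, intervalIntegral.integral_const_mul δ,
      intervalIntegral.integral_const, smul_eq_mul, sub_zero]
    field_simp
  · have h2 := (hm.const_mul r).add (hAzφ.const_mul k)
    rw [mul_zero, add_zero] at h2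
    refine le_of_tendsto h2 ?_
    filter_upwards [hpos] with n hn
    simp only [Function.comp_apply, A]
    have h3 := intervalIntegral.integral_mono (μ := volume) (a := 0) (b := φ n) (Nat.cast_nonneg _)
      (((ix _ _).const_mul r).add ((iz _ _).const_mul k)) intervalIntegrable_const hC
    rw [intervalIntegral.integral_const, smul_eq_mul, sub_zero, intervalIntegral.integral_add
      ((ix _ _).const_mul _) ((iz _ _).const_mul _),
      intervalIntegral.integral_const_mul, intervalIntegral.integral_const_mul] at h3
    have hp : (0 : ℝ) < φ n := lt_of_le_of_ne (Nat.cast_nonneg _) (Ne.symm hn)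
    rw [← mul_div_assoc, ← mul_div_assoc, ← add_div, div_le_iff₀ hp]
    linarith

/-! ### Positive seminorms -/

namespace IsPositiveSeminorm

variable {V : Type*} [AddCommGroup V] [Module ℝ V] {F : V → ℝ}

theorem map_zero (hF : IsPositiveSeminorm F) : F 0 = 0 := by
  simpa using hF.smul_eq 0 le_rfl 0

/-- A linear functional bounded by `M` on the unit ball is bounded by `M * F`. -/
theorem le_mul_of_le_on_unitBall (hF : IsPositiveSeminorm F) {f : V →ₗ[ℝ] ℝ} {M : ℝ}
    (hf : ∀ v, F v ≤ 1 → f v ≤ M) (v : V) : f v ≤ M * F v := by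
  rcases eq_or_ne v 0 with rfl | hv
  · simp [hF.map_zero]
  have hpos := hF.pos v hv
  have h := hf ((F v)⁻¹ • v)
    (by rw [hF.smul_eq _ (inv_nonneg.2 hpos.le), inv_mul_cancel₀ hpos.ne'])
  rwa [map_smul, smul_eq_mul, inv_mul_le_iff₀ hpos, mul_comm] at h

/-- On a finite-dimensional space a positive seminorm dominates a multiple of the norm. -/
theorem exists_mul_norm_le {V : Type*} [NormedAddCommGroup V] [NormedSpace ℝ V]
    [FiniteDimensional ℝ V] {F : V → ℝ} (hF : IsPositiveSeminorm F) :
    ∃ m > 0, ∀ v, m * ‖v‖ ≤ F v := by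
  have hconv : ConvexOn ℝ univ F := ⟨convex_univ, fun x _ y _ a b ha hb _ =>
    (hF.add_le _ _).trans (by rw [hF.smul_eq a ha, hF.smul_eq b hb]; rfl)⟩
  have hcont : Continuous F := hconv.locallyLipschitz.continuous
  rcases subsingleton_or_nontrivial V with hV | hV
  · exact ⟨1, one_pos, fun v => by simp [Subsingleton.elim v 0, hF.map_zero]⟩
  obtain ⟨w, hw, hmin⟩ := (isCompact_sphere (0 : V) 1).exists_isMinOn
    (NormedSpace.sphere_nonempty.2 zero_le_one) hcont.continuousOn
  have hw0 : w ≠ 0 := ne_zero_of_mem_unit_sphere ⟨w, hw⟩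
  refine ⟨F w, hF.pos w hw0, fun v => ?_⟩
  rcases eq_or_ne v 0 with rfl | hv
  · simp [hF.map_zero]
  have hn : 0 < ‖v‖ := norm_pos_iff.2 hv
  have h : F w ≤ F (‖v‖⁻¹ • v) := hmin (by simp [norm_smul, hn.ne'])
  rwa [hF.smul_eq _ (inv_nonneg.2 hn.le), le_inv_mul_iff₀ hn, mul_comm] at h

end IsPositiveSeminorm

/-! ### The Maurer–Cartan form -/

section InvariantFields

variable {E : Type*} [NormedAddCommGroup E] [NormedSpace ℝ E]
  {H : Type*} [TopologicalSpace H] {I : ModelWithCorners ℝ E H}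
  {G : Type*} [TopologicalSpace G] [ChartedSpace H G]

/-- The derivative of a `C¹` function along a curve. -/
theorem HasMFDerivAt.hasDerivAt_comp_smulRight {γ : ℝ → G} {t : ℝ} {v : TangentSpace I (γ t)}
    (hγ : HasMFDerivAt 𝓘(ℝ, ℝ) I γ t ((1 : ℝ →L[ℝ] ℝ).smulRight v)) {f : G → ℝ}
    (hf : MDifferentiableAt I 𝓘(ℝ, ℝ) f (γ t)) :
    HasDerivAt (fun τ => f (γ τ)) (mvfderiv I f (γ t) v) t := by
  have h : HasFDerivAt (fun τ => f (γ τ)) ((mvfderiv I f (γ t)).comp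
      ((1 : ℝ →L[ℝ] ℝ).smulRight v)) t :=
    hasMFDerivAt_iff_hasFDerivAt.1 (hf.hasMFDerivAt.comp t hγ)
  refine h.hasDerivAt.congr_deriv ?_
  exact congrArg (mvfderiv I f (γ t)) (one_smul ℝ v)

/-- An integral curve of a `C¹` vector field is absolutely continuous. -/
theorem IsMIntegralCurve.isACCurve [IsManifold I 1 G]
    {γ : ℝ → G} {X : (x : G) → TangentSpace I x}
    (hγ : IsMIntegralCurve (I := I) γ X) (hX : IsC1VectorField I X) : IsACCurve I γ := by
  refine ⟨hγ.continuous, fun f hf a b => ?_⟩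
  refine absolutelyContinuousOnInterval_of_hasDerivAt
    (fun t => (hγ t).hasDerivAt_comp_smulRight (hf.mdifferentiable one_ne_zero _)) ?_ a b
  have h1 : Continuous (fun t => (⟨γ t, X (γ t)⟩ : TangentBundle I G)) :=
    hX.continuous.comp hγ.continuous
  have h2 := (hf.continuous_tangentMap le_rfl).comp h1
  exact ((contMDiff_snd_tangentBundle_modelSpace (n := 1) ℝ 𝓘(ℝ, ℝ)).continuous).comp h2

variable [Group G]

variable (I) in
/-- The Maurer–Cartan form of `G`: it carries a tangent vector at `g` to the Lie algebra by the
differential of the left translation by `g⁻¹`. The codomain is written as the tangent space at `1`,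
which agrees by definition with the tangent space at `g⁻¹ * g`. -/
noncomputable def maurerCartan (g : G) : TangentSpace I g →L[ℝ] GroupLieAlgebra I G :=
  mfderiv I I (fun x => g⁻¹ * x) g

theorem apply_maurerCartan_eq_sum {ι : Type*} [Fintype ι]
    (b : Module.Basis ι ℝ (GroupLieAlgebra I G)) (l : GroupLieAlgebra I G →L[ℝ] ℝ) {x : G}
    (w : TangentSpace I x) :
    l (maurerCartan I x w) = ∑ i, b.repr (maurerCartan I x w) i * l (b i) := by
  conv_lhs => rw [← b.sum_repr (maurerCartan I x w), map_sum]
  simp only [map_smul, smul_eq_mul]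

variable [LieGroup I (minSmoothness ℝ 3) G]

theorem mdifferentiableAt_const_mul (a b : G) : MDifferentiableAt I I (fun x => a * x) b :=
  (contMDiff_mul_left (I := I) (n := minSmoothness ℝ 3)).contMDiffAt.mdifferentiableAt
    (lt_of_lt_of_le (by simp) le_minSmoothness |>.ne')

theorem maurerCartan_mulInvariantVectorField (v : GroupLieAlgebra I G) (g : G) :
    maurerCartan I g (mulInvariantVectorField v g) = v := by
  have h := mfderiv_comp (I := I) (I' := I) (I'' := I) (1 : G)
    (mdifferentiableAt_const_mul (I := I) g⁻¹ (g * 1)) (mdifferentiableAt_const_mul (I := I) g 1)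
  have D : (fun x => g⁻¹ * x) ∘ (fun x => g * x) = (id : G → G) := by ext x; simp
  rw [D, mfderiv_id, mul_one] at h
  exact (congrArg (fun L => L v) h).symm

theorem mulInvariantVectorField_maurerCartan {g : G} (w : TangentSpace I g) :
    mulInvariantVectorField (maurerCartan I g w) g = w := by
  have h := mfderiv_comp (I := I) (I' := I) (I'' := I) g
    (mdifferentiableAt_const_mul (I := I) g (g⁻¹ * g)) (mdifferentiableAt_const_mul (I := I) g⁻¹ g)
  have D : (fun x => g * x) ∘ (fun x => g⁻¹ * x) = (id : G → G) := by ext x; simp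
  rw [D, mfderiv_id, inv_mul_cancel] at h
  exact (congrArg (fun L => L w) h).symm

theorem mulInvariantVectorField_injective (g : G) :
    Function.Injective (fun v : GroupLieAlgebra I G => mulInvariantVectorField v g) :=
  fun v w h => by
  simpa only [maurerCartan_mulInvariantVectorField] using congrArg (maurerCartan I g) h

theorem isC1VectorField_mulInvariantVectorField [IsManifold I 1 G] (v : GroupLieAlgebra I G) :
    IsC1VectorField I (G := G) (mulInvariantVectorField v) :=
  (contMDiff_mulInvariantVectorField v).of_le (by simp)

/-- The Maurer–Cartan form is smooth: it pairs `C¹` vector fields with linear functionals on the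
Lie algebra to `C¹` functions. -/
theorem IsC1VectorField.contMDiff_maurerCartan [IsManifold I 1 G]
    {Y : (x : G) → TangentSpace I x} (hY : IsC1VectorField I Y)
    (l : GroupLieAlgebra I G →L[ℝ] ℝ) :
    ContMDiff I 𝓘(ℝ, ℝ) 1 (fun x => l (maurerCartan I x (Y x))) := by
  have h3 : minSmoothness ℝ 3 = 3 := by simp
  have hG : LieGroup I 3 G := h3 ▸ ‹LieGroup I (minSmoothness ℝ 3) G›
  have hG2 : LieGroup I 2 G := LieGroup.of_le (n := 3) (by norm_cast)
  have hM2 : IsManifold I (1 + 1) G := IsManifold.of_le (n := 3) (by norm_cast)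
  -- The differential of the product map at `(x⁻¹, x)` sends `(0, Y x)` to the wanted vector.
  let F₁ : G → TangentBundle I G × TangentBundle I G :=
    fun x => (Bundle.TotalSpace.mk' E x⁻¹ 0, ⟨x, Y x⟩)
  have S₁ : ContMDiff I (I.tangent.prod I.tangent) 1 F₁ := by
    refine ContMDiff.prodMk ?_ hY
    exact (Bundle.contMDiff_zeroSection ℝ (TangentSpace I : G → Type _) (IB := I) (n := 1)).comp
      ((contMDiff_inv I 2).of_le (by norm_cast))
  let F₂ : (TangentBundle I G × TangentBundle I G) → TangentBundle (I.prod I) (G × G) :=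
    (equivTangentBundleProd I G I G).symm
  have S₂ : ContMDiff (I.tangent.prod I.tangent) (I.prod I).tangent 1 F₂ :=
    contMDiff_equivTangentBundleProd_symm
  let F₃ : TangentBundle (I.prod I) (G × G) → TangentBundle I G :=
    tangentMap (I.prod I) I (fun (p : G × G) ↦ p.1 * p.2)
  have S₃ : ContMDiff (I.prod I).tangent I.tangent 1 F₃ := by
    apply ContMDiff.contMDiff_tangentMap (n := 2) _ (m := 1) (by norm_cast)
    exact contMDiff_mul I 2
  have S := (S₃.comp S₂).comp S₁
  have hS : (F₃ ∘ F₂) ∘ F₁ = fun x => (⟨1, maurerCartan I x (Y x)⟩ : TangentBundle I G) := by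
    funext x
    let w : TangentSpace (I.prod I) ((x⁻¹, x) : G × G) := ((0 : E), (Y x : E))
    have hd := mfderiv_prod_eq_add_apply (v := w)
      ((contMDiff_mul I (minSmoothness ℝ 3) (G := G)).mdifferentiableAt
        (lt_of_lt_of_le (by simp) le_minSmoothness |>.ne'))
    refine Bundle.TotalSpace.ext (inv_mul_cancel x) (@heq_of_eq E _ _ (hd.trans ?_))
    exact (congrArg₂ (fun a b : E => a + b)
      (map_zero (mfderiv I I (fun z : G => z * x) x⁻¹)) rfl).trans (zero_add _)
  rw [hS] at S
  intro x
  have h := (Bundle.contMDiffAt_totalSpace.1 (S x)).2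
  -- All values lie in the fibre over `1`, on which the trivialization centred at `1` is the identity.
  have hc : ∀ y : G, (trivializationAt E (TangentSpace I) (1 : G)
      (⟨1, maurerCartan I y (Y y)⟩ : TangentBundle I G)).2 = maurerCartan I y (Y y) := fun y =>
    tangentCoordChange_self (I := I) (mem_extChartAt_source (I := I) (1 : G))
  simp only [hc] at h
  let l' : E →L[ℝ] ℝ := l
  exact l'.contMDiff.contMDiffAt.comp x h

theorem mlieBracket_sum_right {ι : Type*} [IsManifold I (minSmoothness ℝ 2) G] [CompleteSpace E]
    {X : (x : G) → TangentSpace I x} {Y : ι → (x : G) → TangentSpace I x} {x : G}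
    (s : Finset ι) (hY : ∀ i ∈ s, MDifferentiableAt I I.tangent
      (fun x => (⟨x, Y i x⟩ : TangentBundle I G)) x) :
    mlieBracket I X (∑ i ∈ s, Y i) x = ∑ i ∈ s, mlieBracket I X (Y i) x := by
  classical
  induction s using Finset.induction_on with
  | empty => simp
  | insert a s ha ih =>
    rw [Finset.sum_insert ha, Finset.sum_insert ha, mlieBracket_add_right, ih]
    · exact fun i hi => hY i (Finset.mem_insert_of_mem hi)
    · exact hY a (Finset.mem_insert_self _ _)
    · have := MDifferentiableAt.sum_section (s := s) (t := Y) fun i hi =>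
        hY i (Finset.mem_insert_of_mem hi)
      simpa using this

/-- The left-invariant fields form a global frame. -/
theorem eq_sum_repr_maurerCartan {ι : Type*} [Fintype ι]
    (b : Module.Basis ι ℝ (GroupLieAlgebra I G)) (Y : (x : G) → TangentSpace I x) :
    Y = ∑ i, (fun x => b.repr (maurerCartan I x (Y x)) i) •
      (mulInvariantVectorField (b i) : (x : G) → TangentSpace I x) := by
  funext x
  rw [Finset.sum_apply]
  simp only [Pi.smul_apply']
  conv_lhs => rw [← mulInvariantVectorField_maurerCartan (Y x),
    ← b.sum_repr (maurerCartan I x (Y x))]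
  unfold mulInvariantVectorField
  rw [map_sum]
  simp only [map_smul]
  rfl

theorem IsC1VectorField.contMDiff_repr_maurerCartan [IsManifold I 1 G] [FiniteDimensional ℝ E]
    {ι : Type*} (b : Module.Basis ι ℝ (GroupLieAlgebra I G)) {Y : (x : G) → TangentSpace I x}
    (hY : IsC1VectorField I Y) (i : ι) :
    ContMDiff I 𝓘(ℝ, ℝ) 1 (fun x => b.repr (maurerCartan I x (Y x)) i) := by
  let l : E →ₗ[ℝ] ℝ := b.coord i
  let l' : E →L[ℝ] ℝ := LinearMap.toContinuousLinearMap l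
  exact hY.contMDiff_maurerCartan l'

/-- The bracket of a left-invariant field with a field given by its components in a left-invariant
frame. -/
theorem IsC1VectorField.maurerCartan_mlieBracket [IsManifold I (minSmoothness ℝ 2) G]
    [IsManifold I 1 G] [FiniteDimensional ℝ E] [CompleteSpace E] {ι : Type*} [Fintype ι]
    (b : Module.Basis ι ℝ (GroupLieAlgebra I G)) (X : GroupLieAlgebra I G)
    {Y : (x : G) → TangentSpace I x} (hY : IsC1VectorField I Y) (x : G) :
    maurerCartan I x (mlieBracket I (mulInvariantVectorField X) Y x) =
      ∑ i, (mvfderiv I (fun x => b.repr (maurerCartan I x (Y x)) i) x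
        (mulInvariantVectorField X x) • b i + b.repr (maurerCartan I x (Y x)) i • ⁅X, b i⁆) := by
  have hd i := (hY.contMDiff_repr_maurerCartan b i).mdifferentiable one_ne_zero x
  conv_lhs => rw [eq_sum_repr_maurerCartan b Y]
  rw [mlieBracket_sum_right, map_sum]
  · refine Finset.sum_congr rfl fun i _ => ?_
    rw [mlieBracket_smul_right (hd i) (mdifferentiableAt_mulInvariantVectorField _), map_add,
      map_smul, map_smul, maurerCartan_mulInvariantVectorField, ← mulInvariantVector_mlieBracket,
      maurerCartan_mulInvariantVectorField, GroupLieAlgebra.bracket_def]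
  · intro i _
    exact (hd i).smul_section (mdifferentiableAt_mulInvariantVectorField _)

/-! ### The Pontryagin Maximum Principle along integral curves of left-invariant fields -/

/-- The Euler–Poincaré form of the adjoint equation: along an integral curve of a left-invariant
field, a covector function satisfies the adjoint equation as soon as the corresponding curve in the
dual of the Lie algebra satisfies the coadjoint equation. -/
theorem IsC1VectorField.hasDerivAt_pairing_of_coadjoint
    [IsManifold I (minSmoothness ℝ 2) G] [IsManifold I 1 G] [CompleteSpace E]
    [FiniteDimensional ℝ E] {γ : ℝ → G} {X : GroupLieAlgebra I G}
    {l : ℝ → GroupLieAlgebra I G →L[ℝ] ℝ} {t : ℝ}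
    (hγ : HasMFDerivAt 𝓘(ℝ, ℝ) I γ t
      ((1 : ℝ →L[ℝ] ℝ).smulRight (mulInvariantVectorField X (γ t))))
    (hl : ∀ v, HasDerivAt (fun τ => l τ v) (l t ⁅X, v⁆) t)
    {Y : (x : G) → TangentSpace I x} (hY : IsC1VectorField I Y) :
    HasDerivAt (fun τ => l τ (maurerCartan I (γ τ) (Y (γ τ))))
      (l t (maurerCartan I (γ t) (mlieBracket I (mulInvariantVectorField X) Y (γ t)))) t := by
  let b : Module.Basis _ ℝ (GroupLieAlgebra I G) := Module.finBasis ℝ E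
  simp only [hY.maurerCartan_mlieBracket b, apply_maurerCartan_eq_sum b]
  rw [map_sum]
  refine HasDerivAt.fun_sum fun i _ => ?_
  refine (((hγ.hasDerivAt_comp_smulRight
    ((hY.contMDiff_repr_maurerCartan b i).mdifferentiable one_ne_zero _))).mul
      (hl (b i))).congr_deriv ?_
  rw [map_add, map_smul, map_smul, smul_eq_mul, smul_eq_mul]

/-- A control and a curve in the dual of the Lie algebra satisfying the coadjoint equation produce,
by left translation, a solution of the Pontryagin Maximum Principle. -/
theorem satisfiesPMP_of_coadjoint
    [IsManifold I (minSmoothness ℝ 2) G] [IsManifold I 1 G] [CompleteSpace E]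
    [FiniteDimensional ℝ E] {q : Submodule ℝ (GroupLieAlgebra I G)} {F : q → ℝ} {γ : ℝ → G} {u : q}
    (hγ : IsMIntegralCurve (I := I) γ (mulInvariantVectorField (u : GroupLieAlgebra I G)))
    (hu : F u = 1) {l : ℝ → GroupLieAlgebra I G →L[ℝ] ℝ} (hl0 : ∀ t, l t ≠ 0)
    (hl : ∀ v t, HasDerivAt (fun τ => l τ v) (l t ⁅(u : GroupLieAlgebra I G), v⁆) t) {M : ℝ}
    (hM : ∀ t, l t u = M) (hle : ∀ t, ∀ v : q, F v ≤ 1 → l t v ≤ M) :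
    SatisfiesPMP I q F γ (fun _ => u) (fun t => (l t).comp (maurerCartan I (γ t))) M where
  measurable_control := measurable_const
  ac_curve := hγ.isACCurve (isC1VectorField_mulInvariantVectorField _)
  deriv_curve := .of_forall hγ
  arclength := .of_forall fun _ => hu
  ne_zero t h := hl0 t <| by
    ext v
    have := congrArg (fun L => L (mulInvariantVectorField v (γ t))) h
    simpa [maurerCartan_mulInvariantVectorField] using! this
  ac_covector Y hY a b := by
    let e : Module.Basis _ ℝ (GroupLieAlgebra I G) := Module.finBasis ℝ E
    have hac := (hγ.isACCurve (isC1VectorField_mulInvariantVectorField _)).2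
    simp only [ContinuousLinearMap.comp_apply, apply_maurerCartan_eq_sum e]
    refine absolutelyContinuousOnInterval_sum _ fun i _ =>
      (hac _ (hY.contMDiff_repr_maurerCartan e i) a b).mul ?_
    exact absolutelyContinuousOnInterval_of_hasDerivAt (hl (e i))
      (continuous_iff_continuousAt.2 fun t => (hl _ t).continuousAt) a b
  adjoint := .of_forall fun t Y hY => hY.hasDerivAt_pairing_of_coadjoint (hγ t) (hl · t)
  hamiltonian_eq := .of_forall fun t => by
    simpa only [ContinuousLinearMap.comp_apply, maurerCartan_mulInvariantVectorField] using hM t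
  hamiltonian_le := .of_forall fun t v hv => by
    simpa only [ContinuousLinearMap.comp_apply, maurerCartan_mulInvariantVectorField]
      using hle t v hv

/-- The exponential map sends a line through the origin to the integral curve through the unit of
the corresponding left-invariant field. -/
theorem isMIntegralCurve_lieExp_mul_smul [IsManifold I 1 G] [CompleteSpace E] [T2Space G]
    [BoundarylessManifold I G] (X : GroupLieAlgebra I G) (c : ℝ) :
    IsMIntegralCurve (I := I) (fun t : ℝ => lieExp I ((t * c) • X))
      (mulInvariantVectorField (c • X)) := by
  obtain ⟨h0, hγ⟩ := (exists_isMIntegralCurve_mulInvariantVectorField I X).choose_spec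
  set γ := (exists_isMIntegralCurve_mulInvariantVectorField I X).choose
  have key : ∀ r : ℝ, lieExp I (r • X) = γ r := fun r => by
    obtain ⟨h0', hγ'⟩ := (exists_isMIntegralCurve_mulInvariantVectorField I (r • X)).choose_spec
    have h := hγ.comp_mul r
    rw [← mulInvariantVectorField_smul] at h
    have := isMIntegralCurve_Ioo_eq_of_contMDiff_boundaryless (t₀ := 0)
      (isC1VectorField_mulInvariantVectorField (r • X)) hγ' h (by simp [h0, h0'])
    have := congrFun this 1
    simpa [lieExp] using! this
  simp only [key, mulInvariantVectorField_smul]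
  exact hγ.comp_mul c

variable [IsManifold I 1 G]
  {q : Submodule ℝ (GroupLieAlgebra I G)} {F : q → ℝ} {γ : ℝ → G} {u : ℝ → q}
  {ψ : (t : ℝ) → (TangentSpace I (γ t) →L[ℝ] ℝ)} {M : ℝ} {X : GroupLieAlgebra I G}

/-- A covector function along a curve, read in the Lie algebra by left translation. -/
noncomputable def leftPairing (ψ : (t : ℝ) → (TangentSpace I (γ t) →L[ℝ] ℝ)) (t : ℝ) :
    GroupLieAlgebra I G →ₗ[ℝ] ℝ :=
  ((ψ t).comp (mfderiv I I (fun x => γ t * x) 1)).toLinearMap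

namespace SatisfiesPMP

theorem continuous_leftPairing (h : SatisfiesPMP I q F γ u ψ M) (v : GroupLieAlgebra I G) :
    Continuous (fun t => leftPairing ψ t v) := by
  have hc := h.ac_covector _ (isC1VectorField_mulInvariantVectorField v)
  have := continuous_of_absolutelyContinuousOnInterval hc
  exact this

/-- Along an integral curve of a left-invariant field the control is determined by the curve. -/
theorem ae_control_eq (h : SatisfiesPMP I q F γ u ψ M)
    (hγ : IsMIntegralCurve (I := I) γ (mulInvariantVectorField X)) :
    ∀ᵐ t, (u t : GroupLieAlgebra I G) = X := by
  filter_upwards [h.deriv_curve] with t ht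
  refine mulInvariantVectorField_injective (γ t) ?_
  have := congrArg (fun L : ℝ →L[ℝ] TangentSpace I (γ t) => L 1) (hasMFDerivAt_unique ht (hγ t))
  simpa using! this

theorem integral_leftPairing_lie [CompleteSpace E] (h : SatisfiesPMP I q F γ u ψ M)
    (hγ : IsMIntegralCurve (I := I) γ (mulInvariantVectorField X)) (v : GroupLieAlgebra I G)
    (a b : ℝ) :
    ∫ t in a..b, leftPairing ψ t ⁅X, v⁆ = leftPairing ψ b v - leftPairing ψ a v := by
  refine integral_eq_sub_of_ae_hasDerivAt (f := fun t => leftPairing ψ t v)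
    (h.ac_covector _ (isC1VectorField_mulInvariantVectorField v) a b) ?_
  filter_upwards [h.adjoint, h.ae_control_eq hγ] with t ht hut
  have := ht _ (isC1VectorField_mulInvariantVectorField v)
  rw [hut, ← mulInvariantVector_mlieBracket] at this
  exact this

theorem leftPairing_eq (h : SatisfiesPMP I q F γ u ψ M)
    (hγ : IsMIntegralCurve (I := I) γ (mulInvariantVectorField X)) (t : ℝ) :
    leftPairing ψ t X = M := by
  have hae : (fun t => leftPairing ψ t X) =ᵐ[volume] fun _ => M := by
    filter_upwards [h.hamiltonian_eq, h.ae_control_eq hγ] with t ht hut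
    rw [hut] at ht
    exact ht
  exact congrFun (((h.continuous_leftPairing X).ae_eq_iff_eq volume continuous_const).1 hae) t

theorem leftPairing_le (h : SatisfiesPMP I q F γ u ψ M) {v : q} (hv : F v ≤ 1) (t : ℝ) :
    leftPairing ψ t (v : GroupLieAlgebra I G) ≤ M :=
  forall_le_of_ae_le (h.continuous_leftPairing _) (h.hamiltonian_le.mono fun _ ht => ht v hv) t

end SatisfiesPMP

end InvariantFields

/-! ### Adapted bases -/

namespace IsAdaptedBasis

variable {L : Type*} [LieRing L] [LieAlgebra ℝ L] {q : Submodule ℝ L}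
  {e : Module.Basis (Fin 4) ℝ L}

theorem coe_vec (he : IsAdaptedBasis q e) (a b c : ℝ) :
    (he.vec a b c : L) = a • e 0 + b • e 1 + c • e 2 := rfl

theorem exists_eq_vec (he : IsAdaptedBasis q e) (v : q) : ∃ a b c, v = he.vec a b c := by
  have h : (v : L) ∈ Submodule.span ℝ {e 0, e 1, e 2} := he.span_eq ▸ v.2
  obtain ⟨a, b, c, h⟩ := Submodule.mem_span_triple.1 h
  exact ⟨a, b, c, Subtype.ext h.symm⟩

theorem smul_vec (he : IsAdaptedBasis q e) (r a b c : ℝ) :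
    r • he.vec a b c = he.vec (r * a) (r * b) (r * c) := by
  ext1
  simp only [Submodule.coe_smul, coe_vec, smul_add, smul_smul]

theorem vec_add_vec (he : IsAdaptedBasis q e) (a b c a' b' c' : ℝ) :
    he.vec a b c + he.vec a' b' c' = he.vec (a + a') (b + b') (c + c') := by
  ext1
  simp only [Submodule.coe_add, coe_vec]
  module

theorem vec_eq_zero (he : IsAdaptedBasis q e) {a b c : ℝ} (h : he.vec a b c = 0) :
    a = 0 ∧ b = 0 ∧ c = 0 := by
  have h : a • e 0 + b • e 1 + c • e 2 = 0 := congrArg Subtype.val h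
  refine ⟨?_, ?_, ?_⟩
  · simpa using congrArg (e.coord 0) h
  · simpa using congrArg (e.coord 1) h
  · simpa using congrArg (e.coord 2) h

theorem isPositiveSeminorm_vec (he : IsAdaptedBasis q e) {F : q → ℝ} (hF : IsPositiveSeminorm F) :
    IsPositiveSeminorm (fun x : Fin 3 → ℝ => F (he.vec (x 0) (x 1) (x 2))) where
  add_le u v := by
    simpa only [vec_add_vec] using!
      hF.add_le (he.vec (u 0) (u 1) (u 2)) (he.vec (v 0) (v 1) (v 2))
  smul_eq c hc u := by
    simpa only [smul_vec] using! hF.smul_eq c hc (he.vec (u 0) (u 1) (u 2))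
  pos u hu := hF.pos _ fun h => hu <| by
    obtain ⟨h0, h1, h2⟩ := he.vec_eq_zero h
    ext i
    fin_cases i <;> assumption

theorem pos_vec (he : IsAdaptedBasis q e) {F : q → ℝ} (hF : IsPositiveSeminorm F) {s : ℝ}
    (hs : s ≠ 0) : 0 < F (he.vec 0 s 0) :=
  hF.pos _ fun h => hs (he.vec_eq_zero h).2.1

theorem bddAbove_support (he : IsAdaptedBasis q e) {F : q → ℝ} (hF : IsPositiveSeminorm F)
    (x y z : ℝ) :
    BddAbove {r : ℝ | ∃ u₁ u₂ u₃ : ℝ, F (he.vec u₁ u₂ u₃) ≤ 1 ∧ r = x * u₁ + y * u₂ + z * u₃} := by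
  obtain ⟨m, hm, hmF⟩ := (he.isPositiveSeminorm_vec hF).exists_mul_norm_le
  refine ⟨(|x| + |y| + |z|) * m⁻¹, ?_⟩
  rintro _ ⟨u₁, u₂, u₃, hu, rfl⟩
  have h : ‖![u₁, u₂, u₃]‖ ≤ m⁻¹ := by
    rw [← one_div, le_div_iff₀' hm]
    exact (hmF ![u₁, u₂, u₃]).trans hu
  have hx : ∀ r a : ℝ, |a| ≤ m⁻¹ → r * a ≤ |r| * m⁻¹ := fun r a ha =>
    (le_abs_self _).trans (by rw [abs_mul]; gcongr)
  have h0 := hx x u₁ ((norm_le_pi_norm ![u₁, u₂, u₃] 0).trans h)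
  have h1 := hx y u₂ ((norm_le_pi_norm ![u₁, u₂, u₃] 1).trans h)
  have h2 := hx z u₃ ((norm_le_pi_norm ![u₁, u₂, u₃] 2).trans h)
  linarith

/-- The covector `(k, s, 0)` attains on the unit ball at least the value `1 / F (0, s, 0)`, at the
normalized vector `(0, s, 0)`; equality means that this vector is a maximizer. -/
theorem support_eq_iff (he : IsAdaptedBasis q e) {F : q → ℝ} (hF : IsPositiveSeminorm F)
    {s : ℝ} (hs : s * s = 1) (k : ℝ) :
    he.support F k s 0 = 1 / F (he.vec 0 s 0) ↔
      ∀ u₁ u₂ u₃, F (he.vec u₁ u₂ u₃) ≤ 1 → k * u₁ + s * u₂ ≤ 1 / F (he.vec 0 s 0) := by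
  have hs0 : s ≠ 0 := left_ne_zero_of_mul_eq_one hs
  have hN := he.pos_vec hF hs0
  set N := F (he.vec 0 s 0)
  have hmem : 1 / N ∈ {r : ℝ | ∃ u₁ u₂ u₃ : ℝ, F (he.vec u₁ u₂ u₃) ≤ 1 ∧
      r = k * u₁ + s * u₂ + 0 * u₃} := by
    refine ⟨0, N⁻¹ * s, 0, ?_, ?_⟩
    · have h := hF.smul_eq N⁻¹ (inv_nonneg.2 hN.le) (he.vec 0 s 0)
      rw [smul_vec, mul_zero, inv_mul_cancel₀ hN.ne'] at h
      exact h.le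
    · rw [mul_left_comm, hs]
      ring
  constructor
  · intro h u₁ u₂ u₃ hu
    rw [← h]
    exact le_csSup (he.bddAbove_support hF k s 0) ⟨u₁, u₂, u₃, hu, by ring⟩
  · intro h
    refine le_antisymm (csSup_le ⟨_, hmem⟩ ?_) (le_csSup (he.bddAbove_support hF k s 0) hmem)
    rintro _ ⟨u₁, u₂, u₃, hu, rfl⟩
    simpa using h u₁ u₂ u₃ hu

theorem lie_one_zero (he3 : e 2 = ⁅e 0, e 1⁆) : ⁅e 1, e 0⁆ = -e 2 := by
  rw [he3, lie_skew]

theorem lie_one_two (he : IsAdaptedBasis q e) :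
    ⁅e 1, e 2⁆ = structConst e 1 2 0 • e 0 + structConst e 1 2 1 • e 1 +
      structConst e 1 2 2 • e 2 := by
  have h := he.c234
  unfold structConst at h ⊢
  conv_lhs => rw [← e.sum_repr ⁅e 1, e 2⁆, Fin.sum_univ_four, h, zero_smul, add_zero]

theorem lie_one_three (he : IsAdaptedBasis q e) (he3 : e 2 = ⁅e 0, e 1⁆) :
    ⁅e 1, e 3⁆ = structConst e 1 2 1 • e 2 + structConst e 1 2 2 • e 3 := by
  rw [he.e4_eq, leibniz_lie, lie_one_zero he3, he.lie_one_two]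
  simp only [neg_lie, lie_self, lie_add, lie_smul, smul_zero, neg_zero, zero_add, ← he3]

/-- A covector vanishing on `e 2` and `e 3` and on `[e 1, e 2]` is annihilated by the coadjoint
action of `e 1`. -/
theorem apply_lie_one_eq_zero (he : IsAdaptedBasis q e) (he3 : e 2 = ⁅e 0, e 1⁆) {l : L →ₗ[ℝ] ℝ}
    (h2 : l (e 2) = 0) (h3 : l (e 3) = 0)
    (h12 : structConst e 1 2 0 * l (e 0) + structConst e 1 2 1 * l (e 1) = 0) (v : L) :
    l ⁅e 1, v⁆ = 0 := by
  have h : l ∘ₗ (LieAlgebra.ad ℝ L (e 1)) = 0 := by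
    refine e.ext fun i => ?_
    fin_cases i
    · simp [lie_one_zero he3, h2]
    · simp
    · simpa [he.lie_one_two, h2] using h12
    · simp [he.lie_one_three he3, h2, h3]
  exact LinearMap.congr_fun h v

/-- The covector `e₄*` is an eigenvector of the coadjoint action of `e₂`. -/
theorem coord_three_lie_one (he : IsAdaptedBasis q e) (he3 : e 2 = ⁅e 0, e 1⁆) (v : L) :
    e.coord 3 ⁅e 1, v⁆ = structConst e 1 2 2 * e.coord 3 v := by
  have h : e.coord 3 ∘ₗ (LieAlgebra.ad ℝ L (e 1)) =
      structConst e 1 2 2 • e.coord 3 := by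
    refine e.ext fun i => ?_
    fin_cases i
    · simp [lie_one_zero he3]
    · simp
    · simp [he.lie_one_two]
    · simp [he.lie_one_three he3]
  exact LinearMap.congr_fun h v

theorem coord_three_vec (he : IsAdaptedBasis q e) (v : q) : e.coord 3 (v : L) = 0 := by
  obtain ⟨a, b, c, rfl⟩ := he.exists_eq_vec v
  simp [coe_vec]

/-- The existence of an equilibrium covector `(k, s, 0)` of the coadjoint flow of `e₂` on the
boundary of the polar of the unit ball, in terms of the structure constants. -/
theorem exists_equilibrium_iff (he : IsAdaptedBasis q e) {F : q → ℝ} (s R : ℝ) :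
    (∃ k, structConst e 1 2 0 * k + structConst e 1 2 1 * s = 0 ∧ he.support F k s 0 = R) ↔
      (structConst e 1 2 0 = 0 ∧ structConst e 1 2 1 * s = 0 ∧ ∃ k, he.support F k s 0 = R) ∨
      (structConst e 1 2 0 ≠ 0 ∧
        he.support F (-(structConst e 1 2 1) * s / structConst e 1 2 0) s 0 = R) := by
  rcases eq_or_ne (structConst e 1 2 0) 0 with h0 | h0
  · simp [h0]
  · have h : ∀ k, structConst e 1 2 0 * k + structConst e 1 2 1 * s = 0 ↔
        k = -(structConst e 1 2 1) * s / structConst e 1 2 0 := fun k => by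
      rw [eq_div_iff h0]
      constructor <;> intro h <;> linarith
    simp [h, h0]

end IsAdaptedBasis

/-! ### Extremality of the one-parameter subgroup of `e₂` -/

section Characterization

variable {E : Type*} [NormedAddCommGroup E] [NormedSpace ℝ E] [FiniteDimensional ℝ E]
  [CompleteSpace E] {H : Type*} [TopologicalSpace H] {I : ModelWithCorners ℝ E H}
  {G : Type*} [TopologicalSpace G] [ChartedSpace H G] [Group G]
  [LieGroup I (minSmoothness ℝ 3) G] [IsManifold I 1 G]
  {q : Submodule ℝ (GroupLieAlgebra I G)} {F : q → ℝ}
  {e : Module.Basis (Fin 4) ℝ (GroupLieAlgebra I G)} {γ : ℝ → G} {s : ℝ}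

omit [CompleteSpace E] [LieGroup I (minSmoothness ℝ 3) G] [IsManifold I 1 G] in
/-- Linear functionals on the Lie algebra are continuous. The Lie algebra, being a tangent space,
carries a topology but no norm; the claim is that of the model space `E`. -/
theorem exists_continuousLinearMap_eq (l : GroupLieAlgebra I G →ₗ[ℝ] ℝ) :
    ∃ l' : GroupLieAlgebra I G →L[ℝ] ℝ, ∀ v, l' v = l v := by
  let l₀ : E →ₗ[ℝ] ℝ := l
  let l' : E →L[ℝ] ℝ := LinearMap.toContinuousLinearMap l₀
  exact ⟨l', fun _ => rfl⟩

namespace IsAdaptedBasis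

omit [FiniteDimensional ℝ E] [IsManifold I 1 G] in
/-- The velocity of the curve has unit length. -/
theorem map_normalized (he : IsAdaptedBasis q e) (hF : IsPositiveSeminorm F) (hs : s * s = 1) :
    F (he.vec 0 (s / F (he.vec 0 s 0)) 0) = 1 := by
  have hN := he.pos_vec hF (left_ne_zero_of_mul_eq_one hs)
  have h := hF.smul_eq _ (inv_nonneg.2 hN.le) (he.vec 0 s 0)
  rwa [smul_vec, mul_zero, inv_mul_cancel₀ hN.ne', inv_mul_eq_div] at h

omit [FiniteDimensional ℝ E] [IsManifold I 1 G] in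
theorem coe_vec_zero_zero (he : IsAdaptedBasis q e) (c : ℝ) :
    (he.vec 0 c 0 : GroupLieAlgebra I G) = c • e 1 := by
  simp [coe_vec]

theorem isAbnormalExtremal (he : IsAdaptedBasis q e) (he3 : e 2 = ⁅e 0, e 1⁆)
    (hF : IsPositiveSeminorm F) (hs : s * s = 1)
    (hγ : IsMIntegralCurve (I := I) γ
      (mulInvariantVectorField ((s / F (he.vec 0 s 0)) • e 1))) :
    IsAbnormalExtremal I q F γ := by
  set c := s / F (he.vec 0 s 0) with hc
  obtain ⟨l, hl⟩ := exists_continuousLinearMap_eq (e.coord 3)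
  rw [← he.coe_vec_zero_zero] at hγ
  -- `e₄*` vanishes on `q` and is multiplied by an exponential along the coadjoint flow.
  refine ⟨_, _, satisfiesPMP_of_coadjoint hγ (he.map_normalized hF hs)
    (l := fun t => Real.exp (c * structConst e 1 2 2 * t) • l) (fun t h => ?_) (fun v t => ?_)
    (fun t => ?_) (fun t v _ => ?_)⟩
  · have h3 := congrArg (fun L => L (e 3)) h
    simp [hl] at h3
  · rw [he.coe_vec_zero_zero]
    simp only [smul_apply, smul_eq_mul, smul_lie, map_smul]
    rw [hl, hl, he.coord_three_lie_one he3]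
    have h := ((hasDerivAt_id t).const_mul (c * structConst e 1 2 2)).exp.mul_const (e.coord 3 v)
    refine h.congr_deriv ?_
    simp only [id]
    ring
  · simp [hl, he.coord_three_vec]
  · simp [hl, he.coord_three_vec]

/-- The covector `(k, s, 0)` on `q`, extended by `0` on `e₄`, is a stationary normal covector. -/
theorem isNormalExtremal_of_equilibrium (he : IsAdaptedBasis q e) (he3 : e 2 = ⁅e 0, e 1⁆)
    (hF : IsPositiveSeminorm F) (hs : s * s = 1)
    (hγ : IsMIntegralCurve (I := I) γ
      (mulInvariantVectorField ((s / F (he.vec 0 s 0)) • e 1))) {k : ℝ}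
    (hk : structConst e 1 2 0 * k + structConst e 1 2 1 * s = 0)
    (hsupp : he.support F k s 0 = 1 / F (he.vec 0 s 0)) :
    IsNormalExtremal I q F γ := by
  have hN := he.pos_vec hF (left_ne_zero_of_mul_eq_one hs)
  rw [he.support_eq_iff hF hs] at hsupp
  set N := F (he.vec 0 s 0) with hNdef
  obtain ⟨l, hl⟩ := exists_continuousLinearMap_eq (k • e.coord 0 + s • e.coord 1)
  have hl0 : l (e 0) = k := by simp [hl]
  have hl1 : l (e 1) = s := by simp [hl]
  have hl2 : l (e 2) = 0 := by simp [hl]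
  have hl3 : l (e 3) = 0 := by simp [hl]
  rw [← he.coe_vec_zero_zero] at hγ
  refine ⟨_, _, 1 / N, one_div_pos.2 hN, satisfiesPMP_of_coadjoint hγ (he.map_normalized hF hs)
    (l := fun _ => l) (fun t h => ?_) (fun v t => ?_) (fun t => ?_) (fun t v hv => ?_)⟩
  · rw [h] at hl1
    exact left_ne_zero_of_mul_eq_one hs hl1.symm
  · have h := he.apply_lie_one_eq_zero he3 (l := l.toLinearMap) hl2 hl3
      (by simpa [hl0, hl1] using! hk) v
    rw [he.coe_vec_zero_zero, smul_lie, map_smul]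
    refine (hasDerivAt_const t (l v)).congr_deriv ?_
    rw [show l ⁅e 1, v⁆ = 0 from h, smul_zero]
  · rw [he.coe_vec_zero_zero, map_smul, hl1, smul_eq_mul, div_mul_eq_mul_div, hs]
  · obtain ⟨u₁, u₂, u₃, rfl⟩ := he.exists_eq_vec v
    rw [coe_vec]
    simp only [map_add, map_smul, hl0, hl1, hl2, smul_eq_mul]
    linarith [hsupp u₁ u₂ u₃ hv]

omit [FiniteDimensional ℝ E] in
/-- An equilibrium is produced from an arbitrary normal covector function by time averaging. -/
theorem exists_equilibrium_of_isNormalExtremal (he : IsAdaptedBasis q e) (he3 : e 2 = ⁅e 0, e 1⁆)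
    (hF : IsPositiveSeminorm F) (hs : s * s = 1)
    (hγ : IsMIntegralCurve (I := I) γ
      (mulInvariantVectorField ((s / F (he.vec 0 s 0)) • e 1)))
    (h : IsNormalExtremal I q F γ) :
    ∃ k, structConst e 1 2 0 * k + structConst e 1 2 1 * s = 0 ∧
      he.support F k s 0 = 1 / F (he.vec 0 s 0) := by
  have hs0 := left_ne_zero_of_mul_eq_one hs
  have hN := he.pos_vec hF hs0
  simp only [he.support_eq_iff hF hs]
  set N := F (he.vec 0 s 0) with hNdef
  obtain ⟨u, ψ, M, hM, h⟩ := h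
  have hc : s / N ≠ 0 := div_ne_zero hs0 hN.ne'
  have hle : ∀ t (v : q), leftPairing ψ t v ≤ M * F v := fun t v =>
    hF.le_mul_of_le_on_unitBall (f := (leftPairing ψ t).comp q.subtype)
      (fun w hw => h.leftPairing_le hw t) v
  -- The unit ball is a neighbourhood of `0` in `q`, hence the covector is bounded on `q`.
  have hbdd : ∀ v : q, ∀ t, |leftPairing ψ t v| ≤ max (M * F v) (M * F (-v)) := fun v t => by
    refine abs_le.2 ⟨?_, (hle t v).trans (le_max_left _ _)⟩
    have := (hle t (-v)).trans (le_max_right (M * F v) _)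
    rw [Submodule.coe_neg, map_neg] at this
    linarith
  have hy : ∀ t, leftPairing ψ t (e 1) = M * N * s := fun t => by
    have h1 := h.leftPairing_eq hγ t
    rw [map_smul, smul_eq_mul] at h1
    field_simp at h1
    linear_combination s * h1 - leftPairing ψ t (e 1) * hs
  have h0 : (he.vec 1 0 0 : GroupLieAlgebra I G) = e 0 := by simp [coe_vec]
  have h2 : (he.vec 0 0 1 : GroupLieAlgebra I G) = e 2 := by simp [coe_vec]
  obtain ⟨m, hm, hlim⟩ := exists_equilibrium_of_bounded (h.continuous_leftPairing (e 0))
    (h.continuous_leftPairing (e 2)) (fun t => h0 ▸ hbdd (he.vec 1 0 0) t)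
    (fun t => h2 ▸ hbdd (he.vec 0 0 1) t) (c := s / N) (α := structConst e 1 2 0)
    (β := structConst e 1 2 1) (δ := structConst e 1 2 2) (y := M * N * s) hc
    (fun T => by
      rw [← h.integral_leftPairing_lie hγ]
      simp only [smul_lie, lie_one_zero he3, smul_neg, map_neg, map_smul, smul_eq_mul, neg_mul])
    (fun T => by
      rw [← h.integral_leftPairing_lie hγ]
      simp only [smul_lie, he.lie_one_two, map_add, map_smul, smul_eq_mul, hy])
  have hMN : M * N ≠ 0 := (mul_pos hM hN).ne'
  -- The covector is normalized so that its value on `e₂` becomes `s`.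
  refine ⟨m / (M * N), ?_, fun u₁ u₂ u₃ hu => ?_⟩
  · field_simp
    linear_combination hm
  · have h3 := hlim u₁ u₃ (M - M * N * s * u₂) fun t => by
      have := h.leftPairing_le hu t
      rw [coe_vec, map_add, map_add, map_smul, map_smul, map_smul, hy] at this
      simp only [smul_eq_mul] at this
      linarith
    rw [div_mul_eq_mul_div, le_div_iff₀ hN]
    field_simp
    nlinarith

end IsAdaptedBasis
end Characterization

theorem theorem1
    {G : Type*} [TopologicalSpace G] [T2Space G] [ConnectedSpace G]
    [ChartedSpace (EuclideanSpace ℝ (Fin 4)) G] [Group G]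
    [LieGroup (𝓡 4) (minSmoothness ℝ 3) G]
    (q : Submodule ℝ (GroupLieAlgebra (𝓡 4) G))
    (hq : Module.finrank ℝ q = 3)
    (hgen : LieSubalgebra.lieSpan ℝ (GroupLieAlgebra (𝓡 4) G)
      (q : Set (GroupLieAlgebra (𝓡 4) G)) = ⊤)
    (F : q → ℝ) (hF : IsPositiveSeminorm F)
    (e : Module.Basis (Fin 4) ℝ (GroupLieAlgebra (𝓡 4) G))
    (he : IsAdaptedBasis q e) (he3 : e 2 = ⁅e 0, e 1⁆)
    (s : ℝ) (hs : s = 1 ∨ s = -1) :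
    IsAbnormalExtremal (𝓡 4) q F
      (fun t => lieExp (𝓡 4) ((s * t / F (he.vec 0 s 0)) • e 1)) ∧
    (IsNonstronglyAbnormal (𝓡 4) q F
      (fun t => lieExp (𝓡 4) ((s * t / F (he.vec 0 s 0)) • e 1)) ↔
      (structConst e 1 2 0 = 0 ∧ structConst e 1 2 1 = 0 ∧
        ∃ k : ℝ, he.support F k s 0 = 1 / F (he.vec 0 s 0)) ∨
      (structConst e 1 2 0 ≠ 0 ∧
        he.support F (-(structConst e 1 2 1) * s / structConst e 1 2 0) s 0 =
          1 / F (he.vec 0 s 0))) := by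
  have hss : s * s = 1 := by rcases hs with rfl | rfl <;> norm_num
  have hs0 : s ≠ 0 := left_ne_zero_of_mul_eq_one hss
  have hγ := isMIntegralCurve_lieExp_mul_smul (I := 𝓡 4) (e 1) (s / F (he.vec 0 s 0))
  have hcurve : (fun t => lieExp (𝓡 4) ((s * t / F (he.vec 0 s 0)) • e 1)) =
      fun t => lieExp (𝓡 4) ((t * (s / F (he.vec 0 s 0))) • e 1) := by
    funext t
    rw [mul_comm s t, mul_div_assoc]
  rw [hcurve]
  have hab := he.isAbnormalExtremal he3 hF hss hγ
  refine ⟨hab, ?_⟩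
  have hiff := he.exists_equilibrium_iff (F := F) s (1 / F (he.vec 0 s 0))
  rw [mul_eq_zero_iff_right hs0] at hiff
  rw [← hiff]
  constructor
  · exact fun h => he.exists_equilibrium_of_isNormalExtremal he3 hF hss hγ h.2
  · rintro ⟨k, hk, hsupp⟩
    exact ⟨hab, he.isNormalExtremal_of_equilibrium he3 hF hss hγ hk hsupp⟩
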